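/- Let $r \ge 1$ be an integer, and let $G$ be a finite simple graph on $n$ vertices. If $G$ is $K_{r+1}$-free (that is, $G$ contains no $r+1$ pairwise adjacent vertices) and has at least $$\left(1-\frac1r\right)\frac{n^2}{2}-\frac{n}{2r}+1$$ edges, then $G$ is $r$-colorable. -/

import Mathlib

open Finset SimpleGraph

/-! Induct on r. Let A be the neighbourhood of a vertex of maximum degree d, and let b be the size
of its complement, so n = d + b. Then e(G) ≤ e(A) + bd, less half the number of missing pairs
between A and its complement, and A has smaller clique number. If A needs as many colours as its
clique bound forbids, the induction hypothesis bounds e(A). Otherwise A has a proper colouring with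
one colour fewer than G is denied, so the complement contains an edge uv. Excluding cliques through
uv then forces at least a_i missing pairs for some colour class size a_i
(`exists_card_colorClass_le_card_not_adj`). Hence 2e ≤ n² - ∑ a_j² - b² - a_i, and Cauchy–Schwarz
finishes. -/

/-- If a vertex set `A` is properly coloured with `r` colours in a `K_{r+2}`-free graph and `u`, `v`
are adjacent vertices of `B`, some colour class is no larger than the number of missing adjacencies
between distinct classes and between `B` and `A`. -/
theorem exists_card_colorClass_le_card_not_adj {V : Type*} [DecidableEq V]
    (G : SimpleGraph V) [DecidableRel G.Adj] {r : ℕ} (hr : 0 < r) (hfree : G.CliqueFree (r + 2))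
    (A B : Finset V) (c : V → Fin r) {u v : V} (hu : u ∈ B) (hv : v ∈ B) (huv : G.Adj u v) :
    ∃ i, #{a ∈ A | c a = i} ≤ #{p ∈ A ×ˢ A | c p.1 ≠ c p.2 ∧ ¬ G.Adj p.1 p.2}
      + #{p ∈ B ×ˢ A | ¬ G.Adj p.1 p.2} := by
  classical
  let C : Fin r → Finset V := fun j => {a ∈ A | c a = j ∧ G.Adj u a ∧ G.Adj v a}
  have : Nonempty (Fin r) := ⟨⟨0, hr⟩⟩
  obtain ⟨i, -, hi⟩ := exists_min_image univ (fun j => #(C j)) univ_nonempty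
  refine ⟨i, ?_⟩
  have hle : ∀ j, #(C i) ≤ #(C j) := fun j => hi j (mem_univ j)
  -- For each `k`, the vertices `φ j k` pick one common neighbour of `u` and `v` from every class;
  -- different `k` give disjoint transversals.
  let φ : Fin r → Fin #(C i) → V := fun j k => ((C j).equivFin.symm (Fin.castLE (hle j) k) : V)
  have hφ : ∀ j k, φ j k ∈ A ∧ c (φ j k) = j ∧ G.Adj u (φ j k) ∧ G.Adj v (φ j k) := fun j k =>
    mem_filter.1 ((C j).equivFin.symm (Fin.castLE (hle j) k)).2
  have hφinj : ∀ j k l, φ j k = φ j l → k = l := fun j k l h => by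
    have h1 := (C j).equivFin.symm.injective (Subtype.ext h)
    exact Fin.castLE_injective (hle j) h1
  -- A transversal with no missing pair would form an (r+2)-clique with `u` and `v`.
  have hmiss : ∀ k, ∃ p : Fin r × Fin r, p.1 ≠ p.2 ∧ ¬ G.Adj (φ p.1 k) (φ p.2 k) := by
    intro k
    by_contra! hadj
    have hinj : Function.Injective fun j => φ j k := fun j l h => by
      have := congrArg c h
      simpa [(hφ j k).2.1, (hφ l k).2.1] using this
    have hclique : G.IsNClique r (univ.image fun j => φ j k) := by
      refine ⟨?_, by simp [card_image_of_injective _ hinj]⟩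
      intro x hx y hy hxy
      simp only [coe_image, coe_univ, Set.image_univ, Set.mem_range] at hx hy
      obtain ⟨j, rfl⟩ := hx
      obtain ⟨l, rfl⟩ := hy
      exact hadj (j, l) fun h => hxy (congrArg (fun j => φ j k) h)
    have hclique₁ := hclique.insert (a := v) (by
      simp only [mem_image, mem_univ, true_and]
      rintro _ ⟨j, rfl⟩
      exact (hφ j k).2.2.2)
    have hclique₂ := hclique₁.insert (a := u) (by
      simp only [mem_insert, mem_image, mem_univ, true_and]
      rintro _ (rfl | ⟨j, rfl⟩)
      · exact huv
      · exact (hφ j k).2.2.1)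
    exact hfree _ hclique₂
  choose q hq using hmiss
  have hcross : #(C i) ≤ #{p ∈ A ×ˢ A | c p.1 ≠ c p.2 ∧ ¬ G.Adj p.1 p.2} := by
    have h := card_le_card_of_injOn (s := (univ : Finset (Fin #(C i))))
      (t := {p ∈ A ×ˢ A | c p.1 ≠ c p.2 ∧ ¬ G.Adj p.1 p.2})
      (fun k => (φ (q k).1 k, φ (q k).2 k))
      (fun k _ => by
        simpa [(hφ _ k).1, (hφ _ k).2.1] using hq k)
      (fun k _ l _ h => by
        have h1 : φ (q k).1 k = φ (q l).1 l := congrArg Prod.fst h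
        have h2 : (q k).1 = (q l).1 := by
          have := congrArg c h1
          rwa [(hφ _ k).2.1, (hφ _ l).2.1] at this
        rw [h2] at h1
        exact hφinj _ _ _ h1)
    simpa using h
  have hrest : #{a ∈ A | c a = i ∧ ¬ (G.Adj u a ∧ G.Adj v a)} ≤ #{p ∈ B ×ˢ A | ¬ G.Adj p.1 p.2} := by
    -- Each such `a` misses `u` or `v`, and is recovered as the second coordinate.
    refine card_le_card_of_injOn (fun a => if G.Adj u a then (v, a) else (u, a)) ?_ ?_
    · intro a ha
      simp only [coe_filter, Set.mem_ofPred_eq] at ha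
      by_cases h : G.Adj u a
      · have : ¬ G.Adj v a := fun h' => ha.2.2 ⟨h, h'⟩
        simp [h, this, hv, ha.1]
      · simp [h, hu, ha.1]
    · intro a _ b _ h
      have := congrArg Prod.snd h
      simp only at this
      split_ifs at this <;> exact this
  have hsplit : #{a ∈ A | c a = i} = #(C i) + #{a ∈ A | c a = i ∧ ¬ (G.Adj u a ∧ G.Adj v a)} := by
    rw [← card_filter_add_card_filter_not (s := {a ∈ A | c a = i})
      (fun a => G.Adj u a ∧ G.Adj v a), filter_filter, filter_filter]
  omega

/-- For a proper colouring of `A`, the ordered pairs in `A` are either adjacent, nonadjacent with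
distinct colours, or of the same colour. -/
theorem card_adj_add_card_not_adj_add_sum_sq {V : Type*} (G : SimpleGraph V)
    [DecidableRel G.Adj] {r : ℕ} (A : Finset V) (c : V → Fin r)
    (hc : ∀ a ∈ A, ∀ b ∈ A, G.Adj a b → c a ≠ c b) :
    #{p ∈ A ×ˢ A | G.Adj p.1 p.2} + #{p ∈ A ×ˢ A | c p.1 ≠ c p.2 ∧ ¬ G.Adj p.1 p.2}
      + ∑ i, #{a ∈ A | c a = i} ^ 2 = #A ^ 2 := by
  classical
  have h1 : #{p ∈ A ×ˢ A | c p.1 = c p.2} = ∑ i, #{a ∈ A | c a = i} ^ 2 := by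
    rw [card_eq_sum_card_fiberwise (f := fun p : V × V => c p.1) (t := univ) (by simp [Set.MapsTo])]
    refine sum_congr rfl fun i _ => ?_
    rw [sq, ← card_product]
    congr 1
    ext ⟨a, b⟩
    simp only [mem_filter, mem_product]
    grind
  have h2 := card_filter_add_card_filter_not (s := A ×ˢ A) (fun p : V × V => c p.1 = c p.2)
  have h3 := card_filter_add_card_filter_not (s := {p ∈ A ×ˢ A | ¬ c p.1 = c p.2})
    (fun p : V × V => G.Adj p.1 p.2)
  have h4 : {p ∈ {p ∈ A ×ˢ A | ¬ c p.1 = c p.2} | G.Adj p.1 p.2}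
      = {p ∈ A ×ˢ A | G.Adj p.1 p.2} := by
    ext ⟨a, b⟩
    simp only [mem_filter, mem_product]
    exact ⟨fun h => ⟨h.1.1, h.2⟩, fun h => ⟨⟨h.1, hc a h.1.1 b h.1.2 h.2⟩, h.2⟩⟩
  rw [h4, filter_filter] at h3
  rw [card_product, h1] at h2
  simp only [ne_eq] at *
  nlinarith

theorem card_filter_adj_product_comm {V : Type*} (G : SimpleGraph V)
    [DecidableRel G.Adj] (A B : Finset V) :
    #{p ∈ A ×ˢ B | G.Adj p.1 p.2} = #{p ∈ B ×ˢ A | G.Adj p.1 p.2} :=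
  card_nbij' Prod.swap Prod.swap (by simp +contextual [Set.MapsTo, G.adj_comm])
    (by simp +contextual [Set.MapsTo, G.adj_comm]) (by simp [Set.LeftInvOn]) (by simp [Set.LeftInvOn])

theorem card_filter_adj_product_eq_sum {V : Type*} (G : SimpleGraph V)
    [DecidableRel G.Adj] (A B : Finset V) :
    #{p ∈ A ×ˢ B | G.Adj p.1 p.2} = ∑ a ∈ A, #{b ∈ B | G.Adj a b} := by
  simp only [card_filter, sum_product]

theorem card_filter_adj_univ_eq_two_mul {V : Type*} [Fintype V] (G : SimpleGraph V)
    [DecidableRel G.Adj] :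
    #{p ∈ (univ : Finset V) ×ˢ (univ : Finset V) | G.Adj p.1 p.2} = 2 * #G.edgeFinset := by
  rw [card_filter_adj_product_eq_sum, ← sum_degrees_eq_twice_card_edges]
  simp [← card_neighborFinset_eq_degree, neighborFinset_eq_filter]

theorem card_filter_adj_eq_two_mul_card_edgeFinset_induce {V : Type*} (G : SimpleGraph V)
    [DecidableRel G.Adj] (A : Finset V) :
    #{p ∈ A ×ˢ A | G.Adj p.1 p.2} = 2 * #(G.induce (A : Set V)).edgeFinset := by
  classical
  rw [← card_filter_adj_univ_eq_two_mul, card_filter_adj_product_eq_sum,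
    card_filter_adj_product_eq_sum, ← sum_coe_sort A]
  refine sum_congr rfl fun a _ => Eq.symm ?_
  refine card_bij (fun (b : (A : Set V)) _ => (b : V)) ?_ ?_ ?_
  · intro b hb
    simpa using hb
  · intro b _ b' _ h
    exact Subtype.ext h
  · intro b hb
    simp only [mem_filter] at hb
    exact ⟨⟨b, hb.1⟩, by simpa using hb.2, rfl⟩

/-- If every vertex of the complement `B` of `A` has degree at most `#A`, then the degree sum is
controlled by the pairs in `A` and the missing pairs between `B` and `A`. -/
theorem two_mul_card_edgeFinset_add_card_not_adj_le {V : Type*} [Fintype V] [DecidableEq V]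
    (G : SimpleGraph V) [DecidableRel G.Adj] (A : Finset V) (hA : ∀ b ∈ Aᶜ, G.degree b ≤ #A) :
    2 * #G.edgeFinset + #{p ∈ Aᶜ ×ˢ A | ¬ G.Adj p.1 p.2}
      ≤ #{p ∈ A ×ˢ A | G.Adj p.1 p.2} + 2 * (#Aᶜ * #A) := by
  have hdeg : ∀ b, G.degree b = #{a ∈ A | G.Adj b a} + #{a ∈ Aᶜ | G.Adj b a} := fun b => by
    rw [← card_neighborFinset_eq_degree, neighborFinset_eq_filter,
      ← card_union_of_disjoint (disjoint_filter_filter disjoint_compl_right), ← filter_union,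
      union_compl]
  have h1 := G.sum_degrees_eq_twice_card_edges
  rw [← sum_add_sum_compl A] at h1
  have h2 : ∑ b ∈ Aᶜ, G.degree b ≤ #Aᶜ * #A := sum_le_card_nsmul _ _ _ hA
  simp only [hdeg, sum_add_distrib, ← card_filter_adj_product_eq_sum] at h1 h2
  have h3 := card_filter_add_card_filter_not (s := Aᶜ ×ˢ A) (fun p : V × V => G.Adj p.1 p.2)
  rw [card_product] at h3
  have h4 := card_filter_adj_product_comm G A Aᶜ
  omega

/-- Cauchy–Schwarz for the family with `a i` replaced by `b`; applied to the colour class sizes,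
with `b` the size of the complement of `A`. -/
theorem sq_sub_add_sq_le_card_mul_sum_sq {ι : Type*} [Fintype ι] [DecidableEq ι]
    (a : ι → ℤ) (i : ι) (b : ℤ) :
    (∑ j, a j - a i + b) ^ 2 ≤ Fintype.card ι * (∑ j, a j ^ 2 - a i ^ 2 + b ^ 2) := by
  have h := sq_sum_le_card_mul_sum_sq (s := univ) (f := Function.update a i b)
  have h1 : ∑ j, Function.update a i b j = ∑ j, a j - a i + b := by
    rw [sum_update_of_mem (mem_univ i), ← add_sum_erase univ a (mem_univ i), sdiff_singleton_eq_erase]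
    ring
  have h2 : ∑ j, Function.update a i b j ^ 2 = ∑ j, a j ^ 2 - a i ^ 2 + b ^ 2 := by
    rw [← add_sum_erase univ _ (mem_univ i), ← add_sum_erase univ (fun j => a j ^ 2) (mem_univ i),
      sum_congr rfl fun j hj => by rw [Function.update_of_ne (ne_of_mem_erase hj)]]
    simp only [Function.update_self]
    ring
  rwa [h1, h2, card_univ] at h

/-- Arithmetic of the inductive case. After clearing denominators the slack is t² + t with t = d -
(r+1)b, which is nonnegative because t is an integer. -/
theorem two_mul_mul_lt_of_two_mul_mul_lt {r d b e f : ℤ} (hr : 0 ≤ r)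
    (hf : 2 * (r + 1) * f < r * d ^ 2 - d + 2 * (r + 1)) (he : e ≤ f + b * d) :
    2 * (r + 1 + 1) * e < (r + 1) * (d + b) ^ 2 - (d + b) + 2 * (r + 1 + 1) := by
  have ht : ∀ t : ℤ, 0 ≤ t ^ 2 + t := fun t => by
    rcases le_or_gt 0 t with h | h <;> nlinarith
  have h0 := ht ((r + 2) * d - (r + 1) * (d + b))
  have h1 := mul_le_mul_of_nonneg_left he (by positivity : 0 ≤ 2 * (r + 1) * (r + 2))
  have h2 := mul_lt_mul_of_pos_left hf (by positivity : 0 < r + 2)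
  refine lt_of_mul_lt_mul_left (a := r + 1) ?_ (by positivity)
  linarith

/-- Arithmetic of the colourable case. With t = (r+1)a - n the slack is t² + rt + 2r(r+1), a
quadratic in t with negative discriminant. -/
theorem two_mul_mul_lt_of_two_mul_le {r n a e S : ℤ} (hr : 0 < r)
    (hS : (n - a) ^ 2 ≤ r * (S - a ^ 2)) (he : 2 * e ≤ n ^ 2 - S - a) :
    2 * (r + 1) * e < r * n ^ 2 - n + 2 * (r + 1) := by
  have h0 : 0 < ((r + 1) * a - n) ^ 2 + r * ((r + 1) * a - n) + 2 * r * (r + 1) := by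
    nlinarith [sq_nonneg (2 * ((r + 1) * a - n) + r)]
  have h1 := mul_le_mul_of_nonneg_left he (by positivity : 0 ≤ r * (r + 1))
  have h2 := mul_le_mul_of_nonneg_left hS (by positivity : 0 ≤ r + 1)
  refine lt_of_mul_lt_mul_left (a := r) ?_ hr.le
  linarith

theorem two_mul_mul_card_edgeFinset_lt_of_not_colorable (r : ℕ) :
    ∀ {V : Type*} [Fintype V] (G : SimpleGraph V) [DecidableRel G.Adj],
      G.CliqueFree (r + 2) → ¬ G.Colorable (r + 1) →
      2 * (r + 1 : ℤ) * #G.edgeFinset < r * (Fintype.card V : ℤ) ^ 2 - Fintype.card V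
        + 2 * (r + 1) := by
  induction r with
  | zero =>
    intro V _ G _ hfree hcol
    rw [zero_add, cliqueFree_two] at hfree
    exact absurd (by rw [hfree]; exact ⟨Coloring.mk (fun _ => 0) (by simp)⟩) hcol
  | succ r ih =>
    intro V _ G _ hfree hcol
    classical
    have hne : Nonempty V := by
      by_contra h
      rw [not_nonempty_iff] at h
      exact hcol (Colorable.of_isEmpty _)
    obtain ⟨x, -, hx⟩ := exists_max_image univ (fun v => G.degree v) univ_nonempty
    set A := G.neighborFinset x with hA
    have hbound := two_mul_card_edgeFinset_add_card_not_adj_le G A fun b _ => by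
      rw [hA, card_neighborFinset_eq_degree]
      exact hx b (mem_univ b)
    have hn : #A + #Aᶜ = Fintype.card V := card_add_card_compl A
    generalize hd : #A = d at *
    generalize hb : #Aᶜ = b at *
    rw [← hn]
    have hfreeA : (G.induce (A : Set V)).CliqueFree (r + 2) := by
      intro s hs
      have hs' := (hs.map (f := Function.Embedding.subtype _)).mono
        (SimpleGraph.map_comap_le (Function.Embedding.subtype (· ∈ (A : Set V))) G)
      refine hfree _ (hs'.insert (a := x) ?_)
      intro y hy
      obtain ⟨z, -, rfl⟩ := mem_map.1 hy
      have hz := z.2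
      simpa [hA] using hz
    by_cases hcolA : (G.induce (A : Set V)).Colorable (r + 1)
    · obtain ⟨C⟩ := hcolA
      let c : V → Fin (r + 1) := fun v => if h : v ∈ A then C ⟨v, h⟩ else 0
      have hc : ∀ a ∈ A, ∀ b ∈ A, G.Adj a b → c a ≠ c b := fun a ha b hb hab => by
        simp only [c, ha, hb, dite_true]
        exact C.valid hab
      -- If `Aᶜ` were independent, one extra colour on it would properly colour `G`.
      have huv : ∃ u ∈ Aᶜ, ∃ v ∈ Aᶜ, G.Adj u v := by
        by_contra! h
        refine hcol ⟨Coloring.mk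
          (fun v => if v ∈ A then (c v).castSucc else Fin.last (r + 1)) ?_⟩
        intro u v huv
        by_cases hu : u ∈ A <;> by_cases hv : v ∈ A
        · simpa [hu, hv] using hc u hu v hv huv
        · simp [hu, hv, (Fin.castSucc_lt_last _).ne]
        · simp [hu, hv, (Fin.castSucc_lt_last _).ne']
        · exact absurd huv (h u (by simpa using hu) v (by simpa using hv))
      obtain ⟨u, hu, v, hv, huv⟩ := huv
      obtain ⟨i, hi⟩ :=
        exists_card_colorClass_le_card_not_adj G r.succ_pos hfree A Aᶜ c hu hv huv
      have hAA := card_adj_add_card_not_adj_add_sum_sq G A c hc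
      have hsum : ∑ j, #{a ∈ A | c a = j} = d := by
        rw [← hd]
        exact (card_eq_sum_card_fiberwise (by simp [Set.MapsTo])).symm
      rw [hd] at hAA
      generalize #{p ∈ A ×ˢ A | G.Adj p.1 p.2} = I at *
      generalize #{p ∈ A ×ˢ A | c p.1 ≠ c p.2 ∧ ¬ G.Adj p.1 p.2} = N at *
      generalize #{p ∈ Aᶜ ×ˢ A | ¬ G.Adj p.1 p.2} = M at *
      have hCS := sq_sub_add_sq_le_card_mul_sum_sq (fun j => (#{a ∈ A | c a = j} : ℤ)) i b
      have hsum' : ∑ j, (#{a ∈ A | c a = j} : ℤ) = d := by exact_mod_cast hsum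
      rw [hsum', Fintype.card_fin] at hCS
      zify at hAA hi hbound
      push_cast at hCS ⊢
      -- Adding `hbound`, `hAA` and `hi` cancels `I`, `N` and `M`, since d² + 2bd = (d + b)² - b².
      refine two_mul_mul_lt_of_two_mul_le (a := #{a ∈ A | c a = i})
        (S := ∑ j, (#{a ∈ A | c a = j} : ℤ) ^ 2 + (b : ℤ) ^ 2) (by positivity) ?_ ?_
      · convert hCS using 1 <;> ring
      · linarith
    · have h := ih _ hfreeA hcolA
      have hI := card_filter_adj_eq_two_mul_card_edgeFinset_induce G A
      have hcard : Fintype.card (A : Set V) = d := by simpa using hd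
      rw [hcard] at h
      rw [hI] at hbound
      have hbound' : (#G.edgeFinset : ℤ) ≤ #(G.induce (A : Set V)).edgeFinset + b * d := by
        exact_mod_cast (by lia : #G.edgeFinset ≤ #(G.induce (A : Set V)).edgeFinset + b * d)
      refine two_mul_mul_lt_of_two_mul_mul_lt (Nat.cast_nonneg r) ?_ hbound'
      convert h

theorem mainTheorem4 {V : Type*} [Fintype V] (G : SimpleGraph V) [Fintype G.edgeSet]
    (n r : ℕ) (hn : Fintype.card V = n) (hr : 1 ≤ r)
    (hfree : G.CliqueFree (r + 1))
    (hedges : (1 - 1 / (r : ℝ)) * ((n : ℝ) ^ 2 / 2) - (n : ℝ) / (2 * (r : ℝ)) + 1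
      ≤ (G.edgeFinset.card : ℝ)) :
    G.Colorable r := by
  classical
  by_contra hcol
  obtain ⟨r, rfl⟩ := Nat.exists_eq_add_of_le' hr
  have h := two_mul_mul_card_edgeFinset_lt_of_not_colorable r G hfree hcol
  -- The two sides differ only in the `Fintype` instance on the edge set.
  have hE : #(@edgeFinset V G G.fintypeEdgeSet) = #G.edgeFinset := by congr!
  rw [hE] at h
  subst hn
  have h' : 2 * (r + 1 : ℝ) * #G.edgeFinset
      < r * (Fintype.card V : ℝ) ^ 2 - Fintype.card V + 2 * (r + 1) := by
    exact_mod_cast h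
  refine absurd h' (not_lt.2 ?_)
  have hr0 : (0 : ℝ) < r + 1 := by positivity
  have := mul_le_mul_of_nonneg_left hedges (by positivity : (0 : ℝ) ≤ 2 * (r + 1))
  refine le_trans (le_of_eq ?_) this
  push_cast
  field_simp
  ring
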